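/- Let $A\in\mathbb{R}^{n\times n}$ and $B\in\mathbb{R}^{n\times m}$. For a real square matrix $M$ let $\alpha(M)=\max\{\mathrm{Re}\,\lambda : \lambda\in\mathbb{C} \text{ is an eigenvalue of } M\}$ denote its spectral abscissa (with $\alpha=-\infty$ for the $0\times 0$ matrix); $M$ is Hurwitz stable if $\alpha(M)<0$. The pair $(A,B)$ is stabilizable if there is $K\in\mathbb{R}^{m\times n}$ such that $A-BK$ is Hurwitz stable. A continuous function $\mathcal{A}:[0,\infty)\to\mathbb{R}^{n\times n}$ is low-gain Hurwitz stable if there exist constants $c,\epsilon^{*}>0$ such that $\alpha(\mathcal{A}(\epsilon))\le -c\,\epsilon$ for all $\epsilon\in[0,\epsilon^{*})$. The pair $(A,B)$ is low-gain stabilizable if there exists a continuous function $K:[0,\infty)\to\mathbb{R}^{m\times n}$ with $K(\epsilon)=O(\epsilon)$ as $\epsilon\to 0^{+}$ such that $\epsilon\mapsto A-BK(\epsilon)$ is low-gain Hurwitz stable. Lemma (Low-gain stabilizability). The pair $(A,B)$ is low-gain stabilizable if and only if $(A,B)$ is stabilizable and every eigenvalue $\lambda\in\mathbb{C}$ of $A$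 satisfies $\mathrm{Re}\,\lambda\le 0$. -/

import Mathlib

open scoped NNReal Topology

namespace LowGain

/-- The set of (complex) eigenvalues of a real square matrix. -/
def eig {n : ℕ} (A : Matrix (Fin n) (Fin n) ℝ) : Set ℂ :=
  {μ : ℂ | Module.End.HasEigenvalue (Matrix.toLin' (A.map (fun x : ℝ => (x : ℂ)))) μ}

/-- The spectral abscissa, the largest real part of an eigenvalue. It is a supremum in the extended
reals, which for `n ≥ 1` is a finite maximum, and for the empty matrix is `-∞`. -/
noncomputable def spectralAbscissa {n : ℕ} (A : Matrix (Fin n) (Fin n) ℝ) : EReal :=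
  ⨆ μ ∈ eig A, ((μ.re : ℝ) : EReal)

/-- Hurwitz stability: all eigenvalues have negative real part. -/
def IsHurwitz {n : ℕ} (A : Matrix (Fin n) (Fin n) ℝ) : Prop :=
  spectralAbscissa A < 0

/-- `(A, B)` is stabilizable: some static state feedback `u = -K x` makes the closed-loop matrix
Hurwitz stable. -/
def IsStabilizable {n m : ℕ} (A : Matrix (Fin n) (Fin n) ℝ) (B : Matrix (Fin n) (Fin m) ℝ) : Prop :=
  ∃ K : Matrix (Fin m) (Fin n) ℝ, IsHurwitz (A - B * K)

/-- Low-gain Hurwitz stability of a matrix-valued function of `ε ∈ [0, ∞)`. -/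
def IsLowGainHurwitz {n : ℕ} (M : ℝ≥0 → Matrix (Fin n) (Fin n) ℝ) : Prop :=
  Continuous M ∧
    ∃ c εs : ℝ, 0 < c ∧ 0 < εs ∧
      ∀ ε : ℝ≥0, (ε : ℝ) < εs → spectralAbscissa (M ε) ≤ ((-(c * ε) : ℝ) : EReal)

/-- The class of feedback gains: continuous maps on `[0, ∞)` which are `O(ε)` as `ε → 0⁺`
(equivalently, entry by entry). -/
def feedbackClass (m n : ℕ) : Set (ℝ≥0 → Matrix (Fin m) (Fin n) ℝ) :=
  {K | Continuous K ∧ ∀ i j, (fun ε : ℝ≥0 => K ε i j) =O[𝓝[>] 0] (fun ε : ℝ≥0 => (ε : ℝ))}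

/-- Low-gain stabilizability of the pair `(A, B)`. -/
def IsLowGainStabilizable {n m : ℕ} (A : Matrix (Fin n) (Fin n) ℝ)
    (B : Matrix (Fin n) (Fin m) ℝ) : Prop :=
  ∃ K ∈ feedbackClass m n, IsLowGainHurwitz (fun ε => A - B * K ε)

end LowGain

namespace LowGain

open Polynomial

/-! ### Polynomial calculus of endomorphisms and Ackermann's formula -/

section Polynomials

variable {V W : Type*} [AddCommGroup V] [Module ℝ V] [AddCommGroup W] [Module ℝ W]

/-! Necessity: continuity and `K = O(ε)` force `K 0 = 0`, so `ε = 0` bounds the spectrum of `A`,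
while any small `ε > 0` gives a stabilizing gain. Sufficiency is induction on dimension
(`exists_lowGain_feedback`). If some `b = B v` is nonzero, with minimal annihilator `p₀`,
Ackermann's formula places the closed-loop polynomial on the cyclic subspace `W` of `b` at `p₀(X +
ε)`: the roots of `p₀`, in the closed left half-plane, move left by `ε`. The gain is polynomial in
`ε` and vanishes at `0` because `p₀(A)` kills `W`. The quotient by `W` is handled by induction, and
once `B = 0` stabilizability makes what remains Hurwitz. -/

theorem aeval_intertwine (π : V →ₗ[ℝ] W) (F : Module.End ℝ V) (G : Module.End ℝ W)
    (h : ∀ x, π (F x) = G (π x)) (q : ℝ[X]) (x : V) :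
    π (aeval F q x) = aeval G q (π x) := by
  have hpow : ∀ (k : ℕ) (x : V), π ((F ^ k) x) = (G ^ k) (π x) := by
    intro k
    induction k with
    | zero => simp
    | succ k ih => intro x; rw [pow_succ, pow_succ, Module.End.mul_apply, Module.End.mul_apply, ih, h]
  induction q using Polynomial.induction_on' with
  | add p q hp hq => simp [hp, hq]
  | monomial k a => simp [aeval_monomial, Module.algebraMap_end_apply, hpow]

/-- Evaluating a shifted polynomial at an endomorphism depends polynomially on the shift. -/
theorem exists_eval_eq_aeval_taylor (A : Module.End ℝ V) (p : ℝ[X]) (l : V →ₗ[ℝ] ℝ) (x : V) :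
    ∃ q : ℝ[X], ∀ ε : ℝ, l (aeval A (taylor ε p) x) = q.eval ε := by
  have hpow : ∀ (k : ℕ) (x : V), ∃ q : ℝ[X], ∀ ε : ℝ, l (aeval A ((X + C ε) ^ k) x) = q.eval ε := by
    intro k
    induction k with
    | zero => exact fun x => ⟨C (l x), by simp⟩
    | succ k ih =>
      intro x
      obtain ⟨q₁, h₁⟩ := ih (A x)
      obtain ⟨q₂, h₂⟩ := ih x
      refine ⟨q₁ + X * q₂, fun ε => ?_⟩
      rw [pow_succ, map_mul, Module.End.mul_apply]
      simp [-map_pow, h₁, h₂, Module.algebraMap_end_apply]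
  induction p using Polynomial.induction_on' with
  | add p q hp hq =>
    obtain ⟨q₁, h₁⟩ := hp
    obtain ⟨q₂, h₂⟩ := hq
    exact ⟨q₁ + q₂, fun ε => by simp [h₁, h₂]⟩
  | monomial k a =>
    obtain ⟨q, hq⟩ := hpow k x
    refine ⟨C a * q, fun ε => ?_⟩
    rw [taylor_monomial, map_mul, Module.End.mul_apply, aeval_C, Module.algebraMap_end_apply,
      map_smul, hq]
    simp

/-- A monic polynomial of least degree annihilating a vector. -/
theorem exists_minimal_annihilator [FiniteDimensional ℝ V] (A : Module.End ℝ V) (b : V) :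
    ∃ p : ℝ[X], p.Monic ∧ aeval A p b = 0 ∧
      ∀ q : ℝ[X], q.degree < p.degree → aeval A q b = 0 → q = 0 := by
  classical
  have hex : ∃ d : ℕ, ∃ p : ℝ[X], p.Monic ∧ aeval A p b = 0 ∧ p.natDegree = d :=
    ⟨_, minpoly ℝ A, minpoly.monic (Algebra.IsIntegral.isIntegral A), by simp, rfl⟩
  obtain ⟨p, hp, hpb, hd⟩ := Nat.find_spec hex
  refine ⟨p, hp, hpb, fun q hq hqb => ?_⟩
  by_contra h0
  refine Nat.find_min hex (m := q.natDegree) ?_ ⟨q * C q.leadingCoeff⁻¹,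
    monic_mul_leadingCoeff_inv h0, ?_, natDegree_mul_leadingCoeff_inv q h0⟩
  · rw [← hd]; exact natDegree_lt_natDegree h0 hq
  · rw [mul_comm, map_mul, Module.End.mul_apply, hqb, map_zero]

/-- Ackermann's formula: a functional `l` such that the feedback `l ∘ p(A)` through `b` makes `p`
annihilate the closed loop on the cyclic subspace generated by `b`. -/
theorem exists_ackermann_functional (A : Module.End ℝ V) (b : V) (p₀ : ℝ[X]) (hp₀ : p₀.Monic)
    (hb : b ≠ 0) (h₀ : aeval A p₀ b = 0)
    (hmin : ∀ q : ℝ[X], q.degree < p₀.degree → aeval A q b = 0 → q = 0) :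
    ∃ l : V →ₗ[ℝ] ℝ, ∀ p : ℝ[X], p.Monic → p.natDegree = p₀.natDegree → ∀ F : Module.End ℝ V,
      (∀ q : ℝ[X], F (aeval A q b) = A (aeval A q b) - l (aeval A p (aeval A q b)) • b) →
      ∀ q : ℝ[X], aeval F p (aeval A q b) = 0 := by
  obtain ⟨d, hd⟩ : ∃ d, p₀.natDegree = d + 1 := by
    refine Nat.exists_eq_succ_of_ne_zero fun h => hb ?_
    simpa [eq_one_of_monic_natDegree_zero hp₀ h] using h₀
  have hdeg : p₀.degree = ((d + 1 : ℕ) : WithBot ℕ) := by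
    rw [degree_eq_natDegree hp₀.ne_zero, hd]
  let φ : degreeLT ℝ (d + 1) →ₗ[ℝ] V :=
    ((LinearMap.applyₗ b).comp (aeval A).toLinearMap).comp (degreeLT ℝ (d + 1)).subtype
  have hφ : LinearMap.ker φ = ⊥ := by
    rw [LinearMap.ker_eq_bot']
    rintro ⟨q, hq⟩ h
    exact Subtype.ext (hmin q (by rw [hdeg]; exact mem_degreeLT.1 hq) h)
  obtain ⟨g, hg⟩ := φ.exists_leftInverse_of_injective hφ
  -- Reads off the coefficient of `A ^ d b` in the basis `b, A b, ..., A ^ d b` of the cyclic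
  -- subspace.
  let l : V →ₗ[ℝ] ℝ := ((lcoeff ℝ d).comp (degreeLT ℝ (d + 1)).subtype).comp g
  have hl : ∀ q : ℝ[X], q.degree < ((d + 1 : ℕ) : WithBot ℕ) → l (aeval A q b) = q.coeff d := by
    intro q hq
    have := LinearMap.congr_fun hg ⟨q, mem_degreeLT.2 hq⟩
    change (lcoeff ℝ d) ((g (φ ⟨q, mem_degreeLT.2 hq⟩) : degreeLT ℝ (d + 1)) : ℝ[X]) = _
    rw [show g (φ ⟨q, mem_degreeLT.2 hq⟩) = ⟨q, mem_degreeLT.2 hq⟩ from this]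
    rfl
  have hlpow : ∀ i, i ≤ d → l ((A ^ i) b) = if i = d then 1 else 0 := by
    intro i hi
    have h := hl (X ^ i) (by rw [degree_X_pow]; exact_mod_cast Nat.lt_succ_of_le hi)
    rw [map_pow, aeval_X] at h
    rw [h, coeff_X_pow]
    simp [eq_comm]
  -- Observability: if `r ≠ 0` is the remainder modulo `p₀`, multiplying by `X ^ (d - deg r)` brings
  -- its leading coefficient to degree `d`, where `l` sees it.
  have hsep : ∀ q : ℝ[X], (∀ i, i ≤ d → l ((A ^ i) (aeval A q b)) = 0) → aeval A q b = 0 := by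
    intro q hq
    have hr : aeval A q b = aeval A (q %ₘ p₀) b := by
      conv_lhs => rw [← modByMonic_add_div q p₀]
      rw [map_add, LinearMap.add_apply, mul_comm, map_mul, Module.End.mul_apply, h₀]
      simp
    rw [hr] at hq ⊢
    have hrd : (q %ₘ p₀).degree < ((d + 1 : ℕ) : WithBot ℕ) := hdeg ▸ degree_modByMonic_lt q hp₀
    generalize q %ₘ p₀ = r at hq hrd
    by_cases h0 : r = 0
    · simp [h0]
    exfalso
    have hrn : r.natDegree ≤ d := Nat.lt_succ_iff.1 ((natDegree_lt_iff_degree_lt h0).2 hrd)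
    have h := hq (d - r.natDegree) (Nat.sub_le _ _)
    have e : (A ^ (d - r.natDegree)) (aeval A r b) = aeval A (X ^ (d - r.natDegree) * r) b := by
      simp
    have hne : X ^ (d - r.natDegree) * r ≠ 0 := mul_ne_zero (pow_ne_zero _ X_ne_zero) h0
    rw [e, hl _ ((natDegree_lt_iff_degree_lt hne).1 (by
      rw [natDegree_mul (pow_ne_zero _ X_ne_zero) h0, natDegree_X_pow]; omega)),
      coeff_X_pow_mul', if_pos (Nat.sub_le _ _), Nat.sub_sub_self hrn] at h
    exact h0 (leadingCoeff_eq_zero.1 h)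
  refine ⟨l, fun p hp hpd F hF => ?_⟩
  have hFmem : ∀ q : ℝ[X], ∃ q' : ℝ[X], F (aeval A q b) = aeval A q' b := fun q =>
    ⟨X * q - C (l (aeval A p (aeval A q b))), by
      rw [hF]; simp [Module.algebraMap_end_apply]⟩
  have hFpoly : ∀ r q : ℝ[X], ∃ q' : ℝ[X], aeval F r (aeval A q b) = aeval A q' b := by
    intro r
    induction r using Polynomial.induction_on with
    | C a => exact fun q => ⟨C a * q, by simp [Module.algebraMap_end_apply]⟩
    | add r s hr hs =>
      intro q
      obtain ⟨q₁, h₁⟩ := hr q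
      obtain ⟨q₂, h₂⟩ := hs q
      exact ⟨q₁ + q₂, by simp [h₁, h₂]⟩
    | monomial k a ih =>
      intro q
      obtain ⟨q₁, h₁⟩ := hFmem q
      obtain ⟨q₂, h₂⟩ := ih q₁
      refine ⟨q₂, ?_⟩
      rw [pow_succ, ← mul_assoc, map_mul, Module.End.mul_apply, aeval_X, h₁, h₂]
  -- The feedback acts along `b`, and `l (A ^ i b) = 0` for `i < d`, so `l` first notices it at
  -- power `d + 1`.
  have hpow : ∀ i, i ≤ d → ∀ q : ℝ[X], l ((F ^ i) (aeval A q b)) = l ((A ^ i) (aeval A q b)) := by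
    intro i
    induction i with
    | zero => intro _ q; simp
    | succ i ih =>
      intro hi q
      obtain ⟨q', hq'⟩ := hFmem q
      rw [pow_succ, Module.End.mul_apply, hq', ih (by omega), ← hq', hF, map_sub, map_sub,
        map_smul, map_smul, hlpow i (by omega), if_neg (by omega), pow_succ, Module.End.mul_apply]
      simp
  have hpow' : ∀ q : ℝ[X], l ((F ^ (d + 1)) (aeval A q b)) =
      l ((A ^ (d + 1)) (aeval A q b)) - l (aeval A p (aeval A q b)) := by
    intro q
    obtain ⟨q', hq'⟩ := hFmem q
    rw [pow_succ, Module.End.mul_apply, hq', hpow d le_rfl, ← hq', hF, map_sub, map_sub,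
      map_smul, map_smul, hlpow d le_rfl, if_pos rfl, pow_succ, Module.End.mul_apply]
    simp
  have hlp : ∀ q : ℝ[X], l (aeval F p (aeval A q b)) = 0 := by
    intro q
    have hexp : ∀ G : Module.End ℝ V, l (aeval G p (aeval A q b)) =
        ∑ i ∈ Finset.range (d + 1), p.coeff i * l ((G ^ i) (aeval A q b)) +
          l ((G ^ (d + 1)) (aeval A q b)) := by
      intro G
      have hc : p.coeff (d + 1) = 1 := by rw [← hd, ← hpd]; exact hp
      rw [aeval_eq_sum_range, hpd, hd, Finset.sum_range_succ, hc]
      simp [LinearMap.sum_apply]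
    rw [hexp F, hpow', Finset.sum_congr rfl fun i hi => by
      rw [hpow i (Nat.lt_succ_iff.1 (Finset.mem_range.1 hi))]]
    have := hexp A
    linarith
  -- `y = p(F) x` satisfies `l (F ^ i y) = l (p(F) (F ^ i x)) = 0` for `i ≤ d`, hence `y = 0` by
  -- `hsep`.
  intro q
  obtain ⟨q', hq'⟩ := hFpoly p q
  rw [hq']
  refine hsep q' fun i hi => ?_
  obtain ⟨q₁, h₁⟩ := hFpoly (X ^ i) q
  rw [← hpow i hi, ← hq', ← aeval_X_pow (R := ℝ) F, ← Module.End.mul_apply, ← map_mul, mul_comm,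
    map_mul, Module.End.mul_apply, h₁, hlp]

end Polynomials

/-! ### Construction of the low-gain feedback by induction on dimension -/

section Feedback

variable {m : ℕ}

/-- Every quotient on which the input has no effect is Hurwitz stable. -/
def HasHurwitzUncontrollablePart {V : Type*} [AddCommGroup V] [Module ℝ V] (A : Module.End ℝ V)
    (B : (Fin m → ℝ) →ₗ[ℝ] V) : Prop :=
  ∀ W : Submodule ℝ V, (∀ x ∈ W, A x ∈ W) → (∀ u, B u ∈ W) →
    ∃ p : ℝ[X], p ≠ 0 ∧ (∀ z : ℂ, aeval z p = 0 → z.re < 0) ∧ ∀ x, aeval A p x ∈ W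

theorem exists_root_bound (p : ℝ[X]) (hp : p ≠ 0) (h : ∀ z : ℂ, aeval z p = 0 → z.re < 0) :
    ∃ r : ℝ, 0 < r ∧ ∀ z : ℂ, aeval z p = 0 → z.re ≤ -r := by
  have hfin : {z : ℂ | aeval z p = 0}.Finite := by
    refine (p.rootSet_finite ℂ).subset fun z hz => ?_
    exact (mem_rootSet.2 ⟨hp, hz⟩)
  rcases {z : ℂ | aeval z p = 0}.eq_empty_or_nonempty with he | hne
  · exact ⟨1, one_pos, fun z hz => absurd (show z ∈ {z : ℂ | aeval z p = 0} from hz) (by simp [he])⟩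
  · obtain ⟨w, hw, hmax⟩ := Set.exists_max_image _ Complex.re hfin hne
    exact ⟨-w.re, neg_pos.2 (h w hw), fun z hz => by simpa using hmax z hz⟩

/-- Abstract spaces let the induction pass to `V ⧸ W`, and annihilating polynomials replace spectra,
since they multiply along the extension of `V ⧸ W` by `W`. -/
theorem exists_lowGain_feedback (d : ℕ) : ∀ {V : Type} [AddCommGroup V] [Module ℝ V]
    [FiniteDimensional ℝ V] (A : Module.End ℝ V) (B : (Fin m → ℝ) →ₗ[ℝ] V),
    Module.finrank ℝ V ≤ d →
    (∃ p : ℝ[X], aeval A p = 0 ∧ ∀ z : ℂ, aeval z p = 0 → z.re ≤ 0) →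
    HasHurwitzUncontrollablePart A B →
    ∃ K : ℝ → V →ₗ[ℝ] (Fin m → ℝ),
      (∀ x i, ∃ q : ℝ[X], q.eval 0 = 0 ∧ ∀ ε, K ε x i = q.eval ε) ∧
      ∃ εs : ℝ, 0 < εs ∧ ∀ ε, 0 ≤ ε → ε < εs → ∃ p : ℝ[X],
        aeval (A - B ∘ₗ K ε) p = 0 ∧ ∀ z : ℂ, aeval z p = 0 → z.re ≤ -ε := by
  induction d with
  | zero =>
    intro V _ _ _ A B hd _ _
    have : Subsingleton V := Module.finrank_zero_iff.1 (Nat.le_zero.1 hd)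
    exact ⟨0, fun x i => ⟨0, by simp, by simp⟩, 1, one_pos, fun ε _ _ => ⟨1,
      LinearMap.ext fun x => Subsingleton.elim _ _, by simp⟩⟩
  | succ d ih =>
    intro V _ _ _ A B hd hA hB
    by_cases h0 : ∀ u, B u = 0
    · obtain ⟨p, hp, hz, hpA⟩ := hB ⊥ (by simp) (by simpa using h0)
      obtain ⟨r, hr, hroot⟩ := exists_root_bound p hp hz
      refine ⟨0, fun x i => ⟨0, by simp, by simp⟩, r, hr, fun ε _ hε => ⟨p, ?_, fun z h => ?_⟩⟩
      · ext x; simpa using hpA x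
      · linarith [hroot z h]
    push Not at h0
    obtain ⟨v, hv⟩ := h0
    obtain ⟨p₀, hp₀, h₀, hmin⟩ := exists_minimal_annihilator A (B v)
    obtain ⟨l, hl⟩ := exists_ackermann_functional A (B v) p₀ hp₀ hv h₀ hmin
    let W : Submodule ℝ V :=
      LinearMap.range ((LinearMap.applyₗ (B v)).comp (aeval (R := ℝ) A).toLinearMap)
    have hW : ∀ x, x ∈ W ↔ ∃ q : ℝ[X], aeval A q (B v) = x := fun x => Iff.rfl
    have hbW : B v ∈ W := (hW _).2 ⟨1, by simp⟩
    have hAW : ∀ x ∈ W, A x ∈ W := by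
      intro x hx
      obtain ⟨q, rfl⟩ := (hW x).1 hx
      exact (hW _).2 ⟨X * q, by simp⟩
    have hrank : Module.finrank ℝ (V ⧸ W) ≤ d := by
      have h1 := W.finrank_quotient_add_finrank
      have h2 : 0 < Module.finrank ℝ W :=
        Module.finrank_pos_iff_exists_ne_zero.2 ⟨⟨B v, hbW⟩, by simpa using hv⟩
      omega
    have hmk : ∀ (q : ℝ[X]) (x : V), W.mkQ (aeval A q x) = aeval (W.mapQ W A hAW) q (W.mkQ x) :=
      aeval_intertwine W.mkQ A (W.mapQ W A hAW) fun x => rfl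
    obtain ⟨pA, hpA, hpAz⟩ := hA
    obtain ⟨K₂, hK₂, εs, hεs, hstab⟩ := ih (W.mapQ W A hAW) (W.mkQ ∘ₗ B) hrank
      ⟨pA, by
        ext x
        have := hmk pA x
        simpa [hpA] using this.symm, hpAz⟩
      (by
        intro Y hY hBY
        obtain ⟨p, hp, hz, hmem⟩ := hB (Y.comap W.mkQ) (fun x hx => hY _ hx) (fun u => hBY u)
        refine ⟨p, hp, hz, fun y => ?_⟩
        obtain ⟨x, rfl⟩ := W.mkQ_surjective y
        rw [← hmk]
        exact hmem x)
    obtain ⟨P, hPW, hP⟩ : ∃ P : Module.End ℝ V, (∀ x, P x ∈ W) ∧ ∀ x ∈ W, P x = x := by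
      obtain ⟨g, hg⟩ := W.subtype.exists_leftInverse_of_injective W.ker_subtype
      exact ⟨W.subtype ∘ₗ g, fun x => (g x).2, fun x hx =>
        congrArg Subtype.val (LinearMap.congr_fun hg ⟨x, hx⟩)⟩
    -- `P` is any linear projection onto `W`; it need not commute with `A`, since the Ackermann term
    -- matters only on `W` and its input `B v` vanishes in the quotient.
    refine ⟨fun ε => K₂ ε ∘ₗ W.mkQ + (l ∘ₗ aeval A (taylor ε p₀) ∘ₗ P).smulRight v, ?_, εs, hεs, ?_⟩
    · intro x i
      obtain ⟨q₂, hq₂, hK⟩ := hK₂ (W.mkQ x) i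
      obtain ⟨q, hq⟩ := exists_eval_eq_aeval_taylor A p₀ l (P x)
      refine ⟨q₂ + q * C (v i), ?_, fun ε => ?_⟩
      · obtain ⟨r, hr⟩ := (hW _).1 (hPW x)
        rw [eval_add, hq₂, eval_mul, ← hq, taylor_zero, ← hr, ← Module.End.mul_apply, ← map_mul,
          mul_comm p₀, map_mul, Module.End.mul_apply, h₀]
        simp
      · simp [← hK, hq]
    · intro ε hε hεlt
      obtain ⟨p₂, hp₂, hz₂⟩ := hstab ε hε hεlt
      set F : Module.End ℝ V :=
        A - B ∘ₗ (K₂ ε ∘ₗ W.mkQ + (l ∘ₗ aeval A (taylor ε p₀) ∘ₗ P).smulRight v) with hF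
      -- Block-triangular argument: `p₂(F)` maps `V` into `W`, and the shifted `p₀` evaluated at `F`
      -- kills `W`.
      refine ⟨taylor ε p₀ * p₂, ?_, ?_⟩
      · have h1 : ∀ x ∈ W, aeval F (taylor ε p₀) x = 0 := by
          intro x hx
          obtain ⟨q, rfl⟩ := (hW x).1 hx
          refine hl _ ?_ (natDegree_taylor _ _) F (fun q => ?_) q
          · exact (leadingCoeff_taylor _ _).trans hp₀
          · have : W.mkQ (aeval A q (B v)) = 0 := by
              simpa using (hW _).2 ⟨q, rfl⟩
            simp only [hF, LinearMap.sub_apply, LinearMap.comp_apply, LinearMap.add_apply, this,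
              map_zero, zero_add, LinearMap.smulRight_apply, map_smul, hP _ ((hW _).2 ⟨q, rfl⟩)]
        have h2 : ∀ x, W.mkQ (aeval F p₂ x) = 0 := by
          intro x
          rw [aeval_intertwine W.mkQ F (W.mapQ W A hAW - (W.mkQ ∘ₗ B) ∘ₗ K₂ ε) ?_ p₂ x, hp₂,
            LinearMap.zero_apply]
          intro x
          have : W.mkQ (B v) = 0 := by simpa using hbW
          simp only [hF, LinearMap.sub_apply, LinearMap.comp_apply, LinearMap.add_apply, map_sub,
            map_add, LinearMap.smulRight_apply, map_smul, this, smul_zero, add_zero]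
          rfl
        ext x
        rw [map_mul, Module.End.mul_apply, LinearMap.zero_apply]
        exact h1 _ (by simpa using h2 x)
      · intro z hz
        rw [map_mul, mul_eq_zero] at hz
        rcases hz with hz | hz
        -- By minimality `p₀` divides `pA`, so its roots inherit the bound `Re ≤ 0`.
        · have hdvd : p₀ ∣ pA := by
            rw [← modByMonic_eq_zero_iff_dvd hp₀]
            refine hmin _ (degree_modByMonic_lt _ hp₀) ?_
            have h := LinearMap.congr_fun hpA (B v)
            rw [← modByMonic_add_div pA p₀, map_add, LinearMap.add_apply, mul_comm, map_mul,
              Module.End.mul_apply, h₀] at h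
            simpa using h
          have hz' : aeval (z + (ε : ℂ)) p₀ = 0 := by
            rw [taylor_apply, aeval_comp] at hz
            simpa using hz
          obtain ⟨s, rfl⟩ := hdvd
          have := hpAz (z + ε) (by rw [map_mul, hz', zero_mul])
          simp only [Complex.add_re, Complex.ofReal_re] at this
          linarith
        · exact hz₂ z hz

end Feedback

/-! ### Transfer between matrices and endomorphisms, and the two implications -/

section Matrices

variable {n m : ℕ}

theorem spectralAbscissa_le_iff (M : Matrix (Fin n) (Fin n) ℝ) (r : ℝ) :
    spectralAbscissa M ≤ (r : EReal) ↔ ∀ μ ∈ eig M, μ.re ≤ r := by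
  simp [spectralAbscissa]

theorem IsHurwitz.re_lt_zero {M : Matrix (Fin n) (Fin n) ℝ} (h : IsHurwitz M) :
    ∀ μ ∈ eig M, μ.re < 0 := fun μ hμ => by
  have : ((μ.re : ℝ) : EReal) < 0 := lt_of_le_of_lt
    (le_iSup₂ (f := fun (μ : ℂ) (_ : μ ∈ eig M) => ((μ.re : ℝ) : EReal)) μ hμ) h
  exact_mod_cast this

theorem aeval_eq_zero_of_mem_eig {M : Matrix (Fin n) (Fin n) ℝ} {p : ℝ[X]} (hp : aeval M p = 0)
    {μ : ℂ} (hμ : μ ∈ eig M) : aeval μ p = 0 := by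
  obtain ⟨x, hx⟩ := Module.End.HasEigenvalue.exists_hasEigenvector hμ
  have h1 : aeval (M.map (fun x : ℝ => (x : ℂ))) (p.map (algebraMap ℝ ℂ)) = 0 := by
    rw [aeval_map_algebraMap]
    have := aeval_algHom_apply ((Algebra.ofId ℝ ℂ).mapMatrix (m := Fin n)) M p
    rw [hp, map_zero] at this
    exact this
  have h2 := Module.End.aeval_apply_of_hasEigenvector (p := p.map (algebraMap ℝ ℂ)) hx
  have h3 : aeval (Matrix.toLin' (M.map (fun x : ℝ => (x : ℂ)))) (p.map (algebraMap ℝ ℂ)) = 0 := by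
    have := aeval_algHom_apply (Matrix.toLinAlgEquiv' (R := ℂ) (n := Fin n)).toAlgHom
      (M.map (fun x : ℝ => (x : ℂ))) (p.map (algebraMap ℝ ℂ))
    rw [h1, map_zero] at this
    exact this
  rw [h3, LinearMap.zero_apply, eq_comm, smul_eq_zero, or_iff_left hx.2, eval_map_algebraMap] at h2
  exact h2

theorem mem_eig_of_aeval_charpoly {M : Matrix (Fin n) (Fin n) ℝ} {z : ℂ}
    (hz : aeval z M.charpoly = 0) : z ∈ eig M := by
  change Module.End.HasEigenvalue _ z
  rw [Module.End.hasEigenvalue_iff_isRoot_charpoly, Matrix.charpoly_toLin']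
  have : (M.map (fun x : ℝ => (x : ℂ))).charpoly = M.charpoly.map (algebraMap ℝ ℂ) :=
    Matrix.charpoly_map M (algebraMap ℝ ℂ)
  rw [this, IsRoot, eval_map_algebraMap, hz]

theorem aeval_toLin' (M : Matrix (Fin n) (Fin n) ℝ) (p : ℝ[X]) :
    aeval (Matrix.toLin' M) p = Matrix.toLin' (aeval M p) :=
  aeval_algHom_apply (Matrix.toLinAlgEquiv' (R := ℝ) (n := Fin n)).toAlgHom M p

/-- Modulo a subspace containing the range of `B`, feedback is invisible: `A` and `A - B * K` induce
the same map, which Cayley–Hamilton annihilates by the closed-loop characteristic polynomial. -/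
theorem IsStabilizable.hasHurwitzUncontrollablePart {A : Matrix (Fin n) (Fin n) ℝ}
    {B : Matrix (Fin n) (Fin m) ℝ} (h : IsStabilizable A B) :
    HasHurwitzUncontrollablePart (Matrix.toLin' A) (Matrix.toLin' B) := by
  obtain ⟨K, hK⟩ := h
  intro W hA hB
  refine ⟨(A - B * K).charpoly, (Matrix.charpoly_monic _).ne_zero, fun z hz =>
    hK.re_lt_zero z (mem_eig_of_aeval_charpoly hz), fun x => ?_⟩
  have hF := aeval_intertwine W.mkQ (Matrix.toLin' (A - B * K)) (W.mapQ W (Matrix.toLin' A) hA)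
    (fun x => by
      have : W.mkQ (Matrix.toLin' B (Matrix.toLin' K x)) = 0 := by
        simpa using hB (Matrix.toLin' K x)
      rw [map_sub, Matrix.toLin'_mul, LinearMap.sub_apply, LinearMap.comp_apply, map_sub, this,
        sub_zero]
      rfl) (A - B * K).charpoly x
  have hG := aeval_intertwine W.mkQ (Matrix.toLin' A) (W.mapQ W (Matrix.toLin' A) hA)
    (fun x => rfl) (A - B * K).charpoly x
  rw [← hG, aeval_toLin', Matrix.aeval_self_charpoly, map_zero, LinearMap.zero_apply,
    map_zero] at hF
  simpa using hF.symm

theorem mem_feedbackClass_apply_zero {K : ℝ≥0 → Matrix (Fin m) (Fin n) ℝ}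
    (hK : K ∈ feedbackClass m n) : K 0 = 0 := by
  ext i j
  have hc : Filter.Tendsto (fun ε : ℝ≥0 => K ε i j) (𝓝[>] 0) (𝓝 (K 0 i j)) :=
    ((hK.1.matrix_elem i j).tendsto 0).mono_left nhdsWithin_le_nhds
  have h0 : Filter.Tendsto (fun ε : ℝ≥0 => (ε : ℝ)) (𝓝[>] 0) (𝓝 0) :=
    (NNReal.continuous_coe.tendsto 0).mono_left nhdsWithin_le_nhds
  exact tendsto_nhds_unique hc ((hK.2 i j).trans_tendsto h0)

theorem IsLowGainStabilizable.isStabilizable {A : Matrix (Fin n) (Fin n) ℝ}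
    {B : Matrix (Fin n) (Fin m) ℝ} (h : IsLowGainStabilizable A B) : IsStabilizable A B := by
  obtain ⟨K, -, -, c, εs, hc, hεs, h⟩ := h
  refine ⟨K ⟨εs / 2, by positivity⟩, lt_of_le_of_lt (h ⟨εs / 2, by positivity⟩ (half_lt_self hεs)) ?_⟩
  have : -(c * (εs / 2)) < 0 := neg_neg_of_pos (by positivity)
  exact_mod_cast this

theorem IsLowGainStabilizable.re_nonpos {A : Matrix (Fin n) (Fin n) ℝ}
    {B : Matrix (Fin n) (Fin m) ℝ} (h : IsLowGainStabilizable A B) : ∀ μ ∈ eig A, μ.re ≤ 0 := by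
  obtain ⟨K, hK, -, c, εs, hc, hεs, h⟩ := h
  have h0 := h 0 (by simpa using hεs)
  rw [spectralAbscissa_le_iff] at h0
  simpa [mem_feedbackClass_apply_zero hK] using h0

theorem isLowGainStabilizable_of_re_nonpos {A : Matrix (Fin n) (Fin n) ℝ}
    {B : Matrix (Fin n) (Fin m) ℝ} (h : IsStabilizable A B) (hA : ∀ μ ∈ eig A, μ.re ≤ 0) :
    IsLowGainStabilizable A B := by
  obtain ⟨K, hK, εs, hεs, hstab⟩ := exists_lowGain_feedback n (Matrix.toLin' A) (Matrix.toLin' B)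
    (by simp) ⟨A.charpoly, by rw [aeval_toLin', Matrix.aeval_self_charpoly, map_zero],
      fun z hz => hA z (mem_eig_of_aeval_charpoly hz)⟩ h.hasHurwitzUncontrollablePart
  have hentry : ∀ i j, ∃ q : ℝ[X], q.eval 0 = 0 ∧
      ∀ ε : ℝ, LinearMap.toMatrix' (K ε) i j = q.eval ε := fun i j => by
    simpa only [LinearMap.toMatrix'_apply] using hK _ i
  have hcont : Continuous fun ε : ℝ≥0 => LinearMap.toMatrix' (K ε) := by
    refine continuous_matrix fun i j => ?_
    obtain ⟨q, -, hq⟩ := hentry i j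
    simp only [hq]
    exact q.continuous.comp NNReal.continuous_coe
  -- The rate is `c = 1` because the roots are shifted by exactly `ε` at each cyclic stage.
  refine ⟨fun ε => LinearMap.toMatrix' (K ε), ⟨hcont, fun i j => ?_⟩,
    continuous_const.sub (continuous_const.matrix_mul hcont), 1, εs, one_pos, hεs, fun ε hε => ?_⟩
  · obtain ⟨q, hq0, hq⟩ := hentry i j
    have hO : (fun ε : ℝ => q.eval ε) =O[𝓝 0] fun ε : ℝ => ε := by
      simpa [hq0] using (q.differentiable.differentiableAt (x := (0 : ℝ))).isBigO_sub
    have h0 : Filter.Tendsto (fun ε : ℝ≥0 => (ε : ℝ)) (𝓝[>] 0) (𝓝 0) :=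
      (NNReal.continuous_coe.tendsto 0).mono_left nhdsWithin_le_nhds
    simpa only [hq, Function.comp_def] using hO.comp_tendsto h0
  · obtain ⟨p, hp, hz⟩ := hstab ε ε.2 hε
    have hM : aeval (A - B * LinearMap.toMatrix' (K ε)) p = 0 := by
      apply (Matrix.toLin' (R := ℝ) (m := Fin n) (n := Fin n)).injective
      rw [← aeval_toLin', map_sub, Matrix.toLin'_mul, Matrix.toLin'_toMatrix', hp, map_zero]
    rw [spectralAbscissa_le_iff]
    intro μ hμ
    rw [one_mul]
    exact hz μ (aeval_eq_zero_of_mem_eig hM hμ)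

end Matrices

end LowGain

theorem mainTheorem5 {n m : ℕ} (A : Matrix (Fin n) (Fin n) ℝ) (B : Matrix (Fin n) (Fin m) ℝ) :
    LowGain.IsLowGainStabilizable A B ↔
      LowGain.IsStabilizable A B ∧ ∀ μ ∈ LowGain.eig A, μ.re ≤ 0 :=
  ⟨fun h => ⟨h.isStabilizable, h.re_nonpos⟩,
    fun h => LowGain.isLowGainStabilizable_of_re_nonpos h.1 h.2⟩
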